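/- A \emph{partitioned Hilbert space} is a tuple $A=(\mathcal H_A,\mathcal Z_A,(\pi_A^k)_{k\in\mathcal Z_A})$, where $\mathcal H_A$ is a finite-dimensional complex Hilbert space, $\mathcal Z_A$ is a finite set, and the $\pi_A^k$ are orthogonal projectors on $\mathcal H_A$ with $\pi_A^k\pi_A^l=\delta^{kl}\pi_A^k$ and $\sum_k\pi_A^k=\mathrm{id}$. The space $\mathcal L(\mathcal H_A)$ of linear operators on $\mathcal H_A$ carries the Hilbert–Schmidt inner product $\langle X,Y\rangle=\mathrm{Tr}(X^\dagger Y)$ and the projectors $\tilde\pi_A^{k,k'}:\rho\mapsto\pi_A^k\rho\,\pi_A^{k'}$, $(k,k')\in\mathcal Z_A\times\mathcal Z_A$; with these it is again a partitioned Hilbert space. A relation $\Lambda:\mathcal Z_A\times\mathcal Z_A\to\mathcal Z_B\times\mathcal Z_B$ is \emph{completely positive} if there are a set $\mathcal Z_E$ and a relation $\lambda:\mathcal Z_A\to\mathcal Z_B\times\mathcal Z_E$ such that $\Lambda$ relates $(k,k')$ to $(l,l')$ if and only if, for some $m\in\mathcal Z_E$, $\lambda$ relates $k$ to $(l,m)$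 and $k'$ to $(l',m)$. A linear map $\mathcal C:\mathcal L(\mathcal H_A)\to\mathcal L(\mathcal H_B)$ is \emph{completely positive} if $\mathcal C(\rho)=\mathrm{Tr}_E(M\rho M^\dagger)$ for some finite-dimensional Hilbert space $\mathcal H_E$ and linear map $M:\mathcal H_A\to\mathcal H_B\otimes\mathcal H_E$. It \emph{follows} $\Lambda$ if $$\mathcal C=\sum_{k,k',l,l'}\Lambda_{kk'}^{ll'}\;\tilde\pi_B^{l,l'}\circ\mathcal C\circ\tilde\pi_A^{k,k'},$$ where $\Lambda_{kk'}^{ll'}\in\{0,1\}$ are the coefficients of $\Lambda$. \textbf{Theorem.} There is a dagger symmetric monoidal category $\mathbf{RoutedCPMFHilb}$ (that is, a symmetric monoidal category with an identity-on-objects contravariant involution $\dagger$ that satisfies $(f\otimes g)^\dagger=f^\dagger\otimes g^\dagger$ and for which associators, unitors and swaps are unitary) in which: \begin{itemize} \item the objects are the partitioned Hilbert spaces $A^{kk'}=(\mathcal L(\mathcal H_A),\mathcal Z_A\times\mathcal Z_A,(\tilde\pi_A^{k,k'})_{k,k'})$ obtained from partitioned Hilbert spaces $A$; \item the morphisms $A^{kk'}\to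 B^{ll'}$ are the pairs $(\Lambda,\mathcal C)$, where $\Lambda:\mathcal Z_A\times\mathcal Z_A\to\mathcal Z_B\times\mathcal Z_B$ is a completely positive relation and $\mathcal C:\mathcal L(\mathcal H_A)\to\mathcal L(\mathcal H_B)$ is a completely positive map that follows $\Lambda$; \item composition is pairwise, $(\Sigma,\mathcal D)\circ(\Lambda,\mathcal C)=(\Sigma\circ\Lambda,\mathcal D\circ\mathcal C)$, and identities are the pairs of identities; \item the tensor product of $A^{kk'}$ and $B^{ll'}$ is the object obtained from $(\mathcal H_A\otimes\mathcal H_B,\mathcal Z_A\times\mathcal Z_B,(\pi_A^k\otimes\pi_B^l)_{k,l})$; it is $\mathcal L(\mathcal H_A\otimes\mathcal H_B)$ with the projectors $\tilde\pi_A^{k,k'}\otimes\tilde\pi_B^{l,l'}$; the tensor product of morphisms is the cartesian product of the routes (with indices reordered accordingly) together with the tensor product of the linear maps; \item the unit object is $\mathcal L(\mathbb C)$ with the trivial partition, obtained from $(\mathbb C,\{*\},(1))$; \item the dagger is $(\Lambda,\mathcal C)^\dagger=(\Lambda^\top,\mathcal C^\dagger)$, with $\Lambda^\top$ the opposite relation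 and $\mathcal C^\dagger$ the adjoint for the Hilbert–Schmidt inner products; \item the associators, unitors and swaps are given by $\rho\mapsto U\rho U^{-1}$ on operators and by $(k,k')\mapsto(e(k),e(k'))$ on indices, where $U$ and $e$ are the canonical associativity, unit and swap isomorphisms of tensor products of Hilbert spaces and of cartesian products of sets. \end{itemize} -/

import Mathlib

open scoped TensorProduct
open CategoryTheory MonoidalCategory

noncomputable section

/-! ### Dagger symmetric monoidal categories -/

/-- A dagger on a symmetric monoidal category: an identity-on-objects contravariant involution that
is compatible with the tensor product and for which the structural isomorphisms are unitary. -/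
class DaggerSymmetricMonoidal (C : Type*) [Category C] [MonoidalCategory C]
    [SymmetricCategory C] where
  dagger : ∀ {X Y : C}, (X ⟶ Y) → (Y ⟶ X)
  dagger_id : ∀ X : C, dagger (𝟙 X) = 𝟙 X
  dagger_comp : ∀ {X Y Z : C} (f : X ⟶ Y) (g : Y ⟶ Z), dagger (f ≫ g) = dagger g ≫ dagger f
  dagger_dagger : ∀ {X Y : C} (f : X ⟶ Y), dagger (dagger f) = f
  dagger_tensor : ∀ {X Y X' Y' : C} (f : X ⟶ Y) (g : X' ⟶ Y'),
    dagger (f ⊗ₘ g) = dagger f ⊗ₘ dagger g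
  dagger_associator : ∀ X Y Z : C, dagger (α_ X Y Z).hom = (α_ X Y Z).inv
  dagger_leftUnitor : ∀ X : C, dagger (λ_ X).hom = (λ_ X).inv
  dagger_rightUnitor : ∀ X : C, dagger (ρ_ X).hom = (ρ_ X).inv
  dagger_braiding : ∀ X Y : C, dagger (β_ X Y).hom = (β_ X Y).inv

namespace Routed

/-! ### The Hilbert space of operators -/

section HilbertSchmidt

variable {H : Type*} [NormedAddCommGroup H] [InnerProductSpace ℂ H] [FiniteDimensional ℂ H]

theorem trace_adjoint_comp_self (X : H →ₗ[ℂ] H) :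
    LinearMap.trace ℂ H (LinearMap.adjoint X ∘ₗ X) =
      ((∑ i, ‖X (stdOrthonormalBasis ℂ H i)‖ ^ 2 : ℝ) : ℂ) := by
  rw [LinearMap.trace_eq_sum_inner _ (stdOrthonormalBasis ℂ H)]
  rw [Complex.ofReal_sum]
  refine Finset.sum_congr rfl fun i _ => ?_
  rw [LinearMap.comp_apply, LinearMap.adjoint_inner_right, inner_self_eq_norm_sq_to_K,
    Complex.ofReal_pow]
  rfl

/-- The Hilbert-Schmidt inner product `⟪X, Y⟫ = Tr (X† Y)` on the operators on `H`. -/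
abbrev hilbertSchmidtCore : InnerProductSpace.Core ℂ (H →ₗ[ℂ] H) where
  inner X Y := LinearMap.trace ℂ H (LinearMap.adjoint X ∘ₗ Y)
  conj_inner_symm X Y := by
    rw [LinearMap.trace_eq_sum_inner _ (stdOrthonormalBasis ℂ H),
      LinearMap.trace_eq_sum_inner _ (stdOrthonormalBasis ℂ H), map_sum]
    refine Finset.sum_congr rfl fun i _ => ?_
    rw [LinearMap.comp_apply, LinearMap.comp_apply, LinearMap.adjoint_inner_right,
      LinearMap.adjoint_inner_right, inner_conj_symm]
  re_inner_nonneg X := by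
    rw [trace_adjoint_comp_self]
    change 0 ≤ ∑ i, ‖X (stdOrthonormalBasis ℂ H i)‖ ^ 2
    exact Finset.sum_nonneg fun i _ => sq_nonneg _
  add_left X Y Z := by rw [map_add, LinearMap.add_comp, map_add]
  smul_left X Y r := by
    rw [map_smulₛₗ, LinearMap.smul_comp, map_smul, smul_eq_mul]
  definite X h := by
    rw [trace_adjoint_comp_self, Complex.ofReal_eq_zero,
      Finset.sum_eq_zero_iff_of_nonneg fun _ _ => sq_nonneg _] at h
    refine (stdOrthonormalBasis ℂ H).toBasis.ext fun i => ?_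
    simpa using h i (Finset.mem_univ i)

instance operatorNormedAddCommGroup : NormedAddCommGroup (H →ₗ[ℂ] H) :=
  (hilbertSchmidtCore (H := H)).toNormedAddCommGroup

instance operatorInnerProductSpace : InnerProductSpace ℂ (H →ₗ[ℂ] H) :=
  .ofCore (hilbertSchmidtCore (H := H)).toCore

theorem operator_inner_def (X Y : H →ₗ[ℂ] H) :
    inner ℂ X Y = LinearMap.trace ℂ H (LinearMap.adjoint X ∘ₗ Y) := rfl

end HilbertSchmidt

/-! ### Partitioned spaces -/

/-- A finite-dimensional Hilbert space with a finite family of pairwise orthogonal orthogonal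
projectors that sum to the identity. -/
structure PartitionedSpace where
  space : Type
  [normed : NormedAddCommGroup space]
  [innerProduct : InnerProductSpace ℂ space]
  [finiteDim : FiniteDimensional ℂ space]
  index : Type
  [fintypeIndex : Fintype index]
  proj : index → (space →ₗ[ℂ] space)
  proj_symmetric : ∀ k, (proj k).IsSymmetric
  proj_idem : ∀ k, proj k ∘ₗ proj k = proj k
  proj_orthogonal : ∀ k l, k ≠ l → proj k ∘ₗ proj l = 0
  sum_proj : ∑ k, proj k = LinearMap.id

attribute [instance] PartitionedSpace.normed PartitionedSpace.innerProduct
  PartitionedSpace.finiteDim PartitionedSpace.fintypeIndex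

namespace PartitionedSpace

/-- `(H_A ⊗ H_B, Z_A × Z_B, (π^k ⊗ μ^l)_{(k,l)})`. -/
@[reducible] def tensor (A B : PartitionedSpace) : PartitionedSpace where
  space := A.space ⊗[ℂ] B.space
  index := A.index × B.index
  proj p := TensorProduct.map (A.proj p.1) (B.proj p.2)
  proj_symmetric p x y := by
    induction x with
    | zero => simp
    | add x x' hx hx' => simp only [map_add, inner_add_left, hx, hx']
    | tmul a b =>
      induction y with
      | zero => simp
      | add y y' hy hy' => simp only [map_add, inner_add_right, hy, hy']
      | tmul c d =>
        simp only [TensorProduct.map_tmul, TensorProduct.inner_tmul]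
        rw [A.proj_symmetric p.1 a c, B.proj_symmetric p.2 b d]
  proj_idem p := by rw [← TensorProduct.map_comp, A.proj_idem, B.proj_idem]
  proj_orthogonal p q h := by
    rw [← TensorProduct.map_comp]
    by_cases h1 : p.1 = q.1
    · have h2 : p.2 ≠ q.2 := fun h2 => h (Prod.ext h1 h2)
      rw [B.proj_orthogonal _ _ h2, TensorProduct.map_zero_right]
    · rw [A.proj_orthogonal _ _ h1, TensorProduct.map_zero_left]
  sum_proj := by
    refine TensorProduct.ext' fun a b => ?_
    have ha : ∑ k, A.proj k a = a := by
      simpa using congrArg (fun f : A.space →ₗ[ℂ] A.space => f a) A.sum_proj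
    have hb : ∑ k, B.proj k b = b := by
      simpa using congrArg (fun f : B.space →ₗ[ℂ] B.space => f b) B.sum_proj
    rw [LinearMap.sum_apply, Fintype.sum_prod_type]
    simp only [TensorProduct.map_tmul, LinearMap.id_apply]
    simp_rw [← TensorProduct.tmul_sum, ← TensorProduct.sum_tmul]
    rw [ha, hb]

/-- The trivial partition of `ℂ`. -/
@[reducible] def unit : PartitionedSpace where
  space := ℂ
  index := Unit
  proj _ := LinearMap.id
  proj_symmetric _ _ _ := rfl
  proj_idem _ := rfl
  proj_orthogonal _ _ h := (h rfl).elim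
  sum_proj := by simp

/-- The operator `π̃^{k,k'} : ρ ↦ π^k ∘ ρ ∘ π^{k'}` on `L(H)`. -/
def sandwich (A : PartitionedSpace) (p : A.index × A.index) :
    (A.space →ₗ[ℂ] A.space) →ₗ[ℂ] (A.space →ₗ[ℂ] A.space) where
  toFun ρ := A.proj p.1 ∘ₗ ρ ∘ₗ A.proj p.2
  map_add' ρ σ := by rw [LinearMap.add_comp, LinearMap.comp_add]
  map_smul' c ρ := by rw [LinearMap.smul_comp, LinearMap.comp_smul, RingHom.id_apply]

/-- `(L(H_A), Z_A × Z_A, (π̃^{k,k'})_{(k,k')})`, with the Hilbert-Schmidt inner product. -/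
@[reducible] def operators (A : PartitionedSpace) : PartitionedSpace where
  space := A.space →ₗ[ℂ] A.space
  index := A.index × A.index
  proj := A.sandwich
  proj_symmetric p X Y := by
    have hs : ∀ k, LinearMap.adjoint (A.proj k) = A.proj k := fun k =>
      ((LinearMap.eq_adjoint_iff _ _).2 (A.proj_symmetric k)).symm
    simp only [operator_inner_def, sandwich, LinearMap.coe_mk, AddHom.coe_mk,
      LinearMap.adjoint_comp, hs]
    simp only [LinearMap.comp_assoc]
    rw [LinearMap.trace_comp_comm']
    simp only [LinearMap.comp_assoc]
  proj_idem p := by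
    ext1 ρ
    simp only [sandwich, LinearMap.coe_mk, AddHom.coe_mk, LinearMap.comp_apply]
    rw [LinearMap.comp_assoc, LinearMap.comp_assoc, A.proj_idem, ← LinearMap.comp_assoc,
      A.proj_idem]
  proj_orthogonal p q h := by
    ext1 ρ
    simp only [sandwich, LinearMap.coe_mk, AddHom.coe_mk, LinearMap.comp_apply,
      LinearMap.zero_apply]
    by_cases h1 : p.1 = q.1
    · have h2 : q.2 ≠ p.2 := fun h2 => h (Prod.ext h1 h2.symm)
      rw [LinearMap.comp_assoc, LinearMap.comp_assoc, A.proj_orthogonal _ _ h2]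
      simp
    · rw [LinearMap.comp_assoc, ← LinearMap.comp_assoc, A.proj_orthogonal _ _ h1,
        LinearMap.zero_comp]
  sum_proj := by
    refine LinearMap.ext fun ρ => ?_
    rw [LinearMap.sum_apply, Fintype.sum_prod_type]
    simp only [sandwich, LinearMap.coe_mk, AddHom.coe_mk]
    have h1 : ∀ k, ∑ k', A.proj k ∘ₗ ρ ∘ₗ A.proj k' = A.proj k ∘ₗ ρ := fun k => by
      refine LinearMap.ext fun x => ?_
      have hx : ∑ k', A.proj k' x = x := by
        simpa using congrArg (fun f : A.space →ₗ[ℂ] A.space => f x) A.sum_proj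
      simp only [LinearMap.sum_apply, LinearMap.comp_apply, ← map_sum, hx]
    refine LinearMap.ext fun x => ?_
    have hx : ∑ k, A.proj k (ρ x) = ρ x := by
      simpa using congrArg (fun f : A.space →ₗ[ℂ] A.space => f (ρ x)) A.sum_proj
    simp only [h1, LinearMap.sum_apply, LinearMap.comp_apply, hx, LinearMap.id_apply]

open Classical in
/-- The linear map `f` follows the route `r`: `f = ∑_{k,l} r_k^l • μ^l ∘ f ∘ π^k`. -/
def Follows (A B : PartitionedSpace) (r : SetRel A.index B.index)
    (f : A.space →ₗ[ℂ] B.space) : Prop :=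
  f = ∑ k, ∑ l, if (k, l) ∈ r then B.proj l ∘ₗ f ∘ₗ A.proj k else 0

end PartitionedSpace

/-! ### Complete positivity -/

/-- The partial trace `Tr_E : L(H ⊗ E) → L(H)`, i.e. the linear map with `X ⊗ Y ↦ Tr(Y) X`. -/
def partialTrace (H E : Type*) [AddCommGroup H] [Module ℂ H] [FiniteDimensional ℂ H]
    [AddCommGroup E] [Module ℂ E] [FiniteDimensional ℂ E] :
    ((H ⊗[ℂ] E) →ₗ[ℂ] (H ⊗[ℂ] E)) →ₗ[ℂ] (H →ₗ[ℂ] H) :=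
  (TensorProduct.rid ℂ (H →ₗ[ℂ] H)).toLinearMap ∘ₗ
    LinearMap.lTensor (H →ₗ[ℂ] H) (LinearMap.trace ℂ E) ∘ₗ
      (homTensorHomEquiv ℂ H E H E).symm.toLinearMap

/-- `C : L(H) → L(K)` is completely positive: `C ρ = Tr_E (M ρ M†)` for some finite-dimensional
Hilbert space `E` and linear map `M : H → K ⊗ E`. -/
def IsCompletelyPositive {H K : Type*}
    [NormedAddCommGroup H] [InnerProductSpace ℂ H] [FiniteDimensional ℂ H]
    [NormedAddCommGroup K] [InnerProductSpace ℂ K] [FiniteDimensional ℂ K]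
    (C : (H →ₗ[ℂ] H) →ₗ[ℂ] (K →ₗ[ℂ] K)) : Prop :=
  ∃ (E : Type) (_ : NormedAddCommGroup E) (_ : InnerProductSpace ℂ E)
    (_ : FiniteDimensional ℂ E) (M : H →ₗ[ℂ] K ⊗[ℂ] E),
    ∀ ρ, C ρ = partialTrace K E (M ∘ₗ ρ ∘ₗ LinearMap.adjoint M)

/-- `Λ : Z × Z → W × W` is completely positive: `Λ_{kk'}^{ll'} = ∑_m r_k^{lm} r_{k'}^{l'm}` for some
set `E` and relation `r : Z → W × E`. -/
def IsCompletelyPositiveRel {Z W : Type*} (Λ : SetRel (Z × Z) (W × W)) : Prop :=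
  ∃ (E : Type) (r : SetRel Z (W × E)), ∀ k k' l l',
    ((k, k'), (l, l')) ∈ Λ ↔ ∃ m, (k, (l, m)) ∈ r ∧ (k', (l', m)) ∈ r

/-! ### Objects and morphisms -/

/-- An object: the partitioned space `operators A` of operators on a partitioned Hilbert space
`A`. -/
structure OperatorSpace where
  base : PartitionedSpace

namespace OperatorSpace

@[reducible] def toPartitionedSpace (A : OperatorSpace) : PartitionedSpace := A.base.operators

@[reducible] def tensor (A B : OperatorSpace) : OperatorSpace := ⟨A.base.tensor B.base⟩

@[reducible] def unit : OperatorSpace := ⟨PartitionedSpace.unit⟩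

end OperatorSpace

/-- A routed completely positive map. -/
@[ext]
structure RoutedCPM (A B : OperatorSpace) where
  route : SetRel (A.base.index × A.base.index) (B.base.index × B.base.index)
  map : (A.base.space →ₗ[ℂ] A.base.space) →ₗ[ℂ] (B.base.space →ₗ[ℂ] B.base.space)
  route_cp : IsCompletelyPositiveRel route
  map_cp : IsCompletelyPositive map
  follows : A.toPartitionedSpace.Follows B.toPartitionedSpace route map

/-- The cartesian product of two routes, with the indices of the product ordered as
`((k, l), (k', l'))`. -/
def routeProd {Z W Z' W' : Type*} (Λ : SetRel (Z × Z) (W × W))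
    (Λ' : SetRel (Z' × Z') (W' × W')) :
    SetRel ((Z × Z') × (Z × Z')) ((W × W') × (W × W')) :=
  {p | ((p.1.1.1, p.1.2.1), (p.2.1.1, p.2.2.1)) ∈ Λ ∧
    ((p.1.1.2, p.1.2.2), (p.2.1.2, p.2.2.2)) ∈ Λ'}

/-- The tensor product of `C : L(H) → L(K)` and `D : L(H') → L(K')`, as the linear map
`L(H ⊗ H') → L(K ⊗ K')` with `X ⊗ Y ↦ C X ⊗ D Y`. -/
def mapTensor {H K H' K' : Type*}
    [AddCommGroup H] [Module ℂ H] [FiniteDimensional ℂ H]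
    [AddCommGroup K] [Module ℂ K] [FiniteDimensional ℂ K]
    [AddCommGroup H'] [Module ℂ H'] [FiniteDimensional ℂ H']
    [AddCommGroup K'] [Module ℂ K'] [FiniteDimensional ℂ K']
    (C : (H →ₗ[ℂ] H) →ₗ[ℂ] (K →ₗ[ℂ] K)) (D : (H' →ₗ[ℂ] H') →ₗ[ℂ] (K' →ₗ[ℂ] K')) :
    ((H ⊗[ℂ] H') →ₗ[ℂ] (H ⊗[ℂ] H')) →ₗ[ℂ] ((K ⊗[ℂ] K') →ₗ[ℂ] (K ⊗[ℂ] K')) :=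
  (homTensorHomEquiv ℂ K K' K K').toLinearMap ∘ₗ TensorProduct.map C D ∘ₗ
    (homTensorHomEquiv ℂ H H' H H').symm.toLinearMap

namespace RoutedCPM

/-- Transport of a routed CPM along equalities of its source and target. -/
def cast {A A' B B' : OperatorSpace} (hA : A = A') (hB : B = B') (f : RoutedCPM A B) :
    RoutedCPM A' B' :=
  hA ▸ hB ▸ f

/-- `h` is the sequential composite `g ∘ f`. -/
def IsComp {A B C : OperatorSpace} (h : RoutedCPM A C) (f : RoutedCPM A B)
    (g : RoutedCPM B C) : Prop :=
  h.route = f.route.comp g.route ∧ h.map = g.map ∘ₗ f.map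

/-- `h` is the parallel composite of `f` and `g`. -/
def IsTensor {A B A' B' : OperatorSpace} (h : RoutedCPM (A.tensor A') (B.tensor B'))
    (f : RoutedCPM A B) (g : RoutedCPM A' B') : Prop :=
  h.route = routeProd f.route g.route ∧ h.map = mapTensor f.map g.map

/-- `h` is `(Λᵀ, C†)`, the adjoint being taken for the Hilbert-Schmidt inner product. -/
def IsAdjoint {A B : OperatorSpace} (h : RoutedCPM B A) (f : RoutedCPM A B) : Prop :=
  h.route = f.route.inv ∧ h.map = LinearMap.adjoint f.map

/-- `h` is the routed CPM `ρ ↦ U ∘ ρ ∘ U⁻¹`, with the route that relates `(k, k')` to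
`(e k, e k')` only. -/
def IsInducedBy {A B : OperatorSpace} (h : RoutedCPM A B) (U : A.base.space ≃ₗ[ℂ] B.base.space)
    (e : A.base.index ≃ B.base.index) : Prop :=
  h.route = {p | p.2 = (e p.1.1, e p.1.2)} ∧
    ∀ ρ, h.map ρ = U.toLinearMap ∘ₗ ρ ∘ₗ U.symm.toLinearMap

end RoutedCPM

end Routed

end

/-!
Routed completely positive maps inherit their structure from linear maps and relations, so the
proof consists of showing that the three defining conditions (completely positive route, completely
positive map, map follows route) are stable under the operations, and that the coherence laws hold.

* Stability of complete positivity is read off from Kraus decompositions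
  `ρ ↦ ∑ i, M i ∘ ρ ∘ (M i)†` (`isCompletelyPositive_iff_kraus`): the Kraus operators of a composite
  are the products, those of a tensor product the tensor products, and those of the Hilbert-Schmidt
  adjoint the adjoints of the given ones. For relations the same three constructions are made with
  the auxiliary set `E` in the role of the environment.
* A map follows a route if and only if its blocks outside of the route vanish
  (`PartitionedSpace.follows_iff`), and in this form the condition passes to composites, tensor
  products and adjoints block by block.
* Every structural morphism is induced by a unitary that permutes the projectors
  (`PartitionedSpace.UnitaryIso`, `RoutedCPM.induced`). Composites, tensor products and adjoints of
  induced morphisms are induced by composites, tensor products and inverses of unitaries, so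
  pentagon, triangle, hexagons, symmetry and unitarity reduce to identities between
  isomorphisms of tensor products of Hilbert spaces, checked on pure tensors.
* Naturality of the structural morphisms, and the compatibility of the adjoint with tensor
  products, are linear in the operator argument, and the operators on `H ⊗ K` are spanned by the
  product operators `X ⊗ Y` (`operator_tensor_ext`).
-/

noncomputable section

namespace Routed

/-! ### Two-sided multiplication on operator spaces -/

section TwoSided

variable {H K L : Type*} [AddCommGroup H] [Module ℂ H] [AddCommGroup K] [Module ℂ K]
  [AddCommGroup L] [Module ℂ L]

/-- The linear map `ρ ↦ M ∘ ρ ∘ N` on operators. Kraus terms (`N = M†`), conjugations by unitaries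
(`N = M⁻¹`) and the projectors of `PartitionedSpace.operators` are all of this form. -/
def twoSided (M : H →ₗ[ℂ] K) (N : K →ₗ[ℂ] H) : (H →ₗ[ℂ] H) →ₗ[ℂ] (K →ₗ[ℂ] K) where
  toFun ρ := M ∘ₗ ρ ∘ₗ N
  map_add' ρ σ := by rw [LinearMap.add_comp, LinearMap.comp_add]
  map_smul' c ρ := by rw [LinearMap.smul_comp, LinearMap.comp_smul, RingHom.id_apply]

@[simp] theorem twoSided_apply (M : H →ₗ[ℂ] K) (N : K →ₗ[ℂ] H) (ρ : H →ₗ[ℂ] H) :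
    twoSided M N ρ = M ∘ₗ ρ ∘ₗ N := rfl

theorem twoSided_comp_twoSided (M : H →ₗ[ℂ] K) (N : K →ₗ[ℂ] H) (M' : K →ₗ[ℂ] L)
    (N' : L →ₗ[ℂ] K) :
    twoSided M' N' ∘ₗ twoSided M N = twoSided (M' ∘ₗ M) (N ∘ₗ N') := rfl

end TwoSided

/-! ### Tensor products of maps between operator spaces -/

section MapTensor

variable {H K L H' K' L' : Type*}
  [AddCommGroup H] [Module ℂ H] [FiniteDimensional ℂ H]
  [AddCommGroup K] [Module ℂ K] [FiniteDimensional ℂ K]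
  [AddCommGroup L] [Module ℂ L] [FiniteDimensional ℂ L]
  [AddCommGroup H'] [Module ℂ H'] [FiniteDimensional ℂ H']
  [AddCommGroup K'] [Module ℂ K'] [FiniteDimensional ℂ K']
  [AddCommGroup L'] [Module ℂ L'] [FiniteDimensional ℂ L']

theorem homTensorHomEquiv_symm_map (X : H →ₗ[ℂ] H) (Y : K →ₗ[ℂ] K) :
    (homTensorHomEquiv ℂ H K H K).symm (TensorProduct.map X Y) = X ⊗ₜ Y := by
  rw [LinearEquiv.symm_apply_eq]
  simp

/-- Two linear maps on `L(H ⊗ K)` agree if they agree on the product operators `X ⊗ Y`. -/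
theorem operator_tensor_ext {V : Type*} [AddCommMonoid V] [Module ℂ V]
    {f g : (H ⊗[ℂ] K →ₗ[ℂ] H ⊗[ℂ] K) →ₗ[ℂ] V}
    (h : ∀ X Y, f (TensorProduct.map X Y) = g (TensorProduct.map X Y)) : f = g := by
  have key : f ∘ₗ (homTensorHomEquiv ℂ H K H K).toLinearMap =
      g ∘ₗ (homTensorHomEquiv ℂ H K H K).toLinearMap := by
    refine TensorProduct.ext' fun X Y => ?_
    simpa using h X Y
  refine LinearMap.ext fun ρ => ?_
  obtain ⟨t, rfl⟩ := (homTensorHomEquiv ℂ H K H K).surjective ρ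
  exact LinearMap.congr_fun key t

/-- Two linear maps on `L((H ⊗ K) ⊗ L)` agree if they agree on the operators `(X ⊗ Y) ⊗ Z`. -/
theorem operator_tensor_ext_threefold {V : Type*} [AddCommMonoid V] [Module ℂ V]
    {f g : ((H ⊗[ℂ] K) ⊗[ℂ] L →ₗ[ℂ] (H ⊗[ℂ] K) ⊗[ℂ] L) →ₗ[ℂ] V}
    (h : ∀ X Y Z, f (TensorProduct.map (TensorProduct.map X Y) Z) =
      g (TensorProduct.map (TensorProduct.map X Y) Z)) : f = g := by
  refine operator_tensor_ext fun W Z => ?_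
  have key : f ∘ₗ (TensorProduct.mapBilinear (.id ℂ) (H ⊗[ℂ] K) L (H ⊗[ℂ] K) L).flip Z =
      g ∘ₗ (TensorProduct.mapBilinear (.id ℂ) (H ⊗[ℂ] K) L (H ⊗[ℂ] K) L).flip Z :=
    operator_tensor_ext fun X Y => h X Y Z
  exact LinearMap.congr_fun key W

@[simp] theorem mapTensor_map (C : (H →ₗ[ℂ] H) →ₗ[ℂ] (K →ₗ[ℂ] K))
    (D : (H' →ₗ[ℂ] H') →ₗ[ℂ] (K' →ₗ[ℂ] K')) (X : H →ₗ[ℂ] H) (Y : H' →ₗ[ℂ] H') :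
    mapTensor C D (TensorProduct.map X Y) = TensorProduct.map (C X) (D Y) := by
  simp [mapTensor, homTensorHomEquiv_symm_map]

theorem mapTensor_comp
    (C : (H →ₗ[ℂ] H) →ₗ[ℂ] (K →ₗ[ℂ] K))
    (D : (H' →ₗ[ℂ] H') →ₗ[ℂ] (K' →ₗ[ℂ] K')) (C' : (K →ₗ[ℂ] K) →ₗ[ℂ] (L →ₗ[ℂ] L))
    (D' : (K' →ₗ[ℂ] K') →ₗ[ℂ] (L' →ₗ[ℂ] L')) :
    mapTensor (C' ∘ₗ C) (D' ∘ₗ D) = mapTensor C' D' ∘ₗ mapTensor C D :=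
  operator_tensor_ext fun X Y => by simp

theorem mapTensor_zero_left (D : (H' →ₗ[ℂ] H') →ₗ[ℂ] (K' →ₗ[ℂ] K')) :
    mapTensor (0 : (H →ₗ[ℂ] H) →ₗ[ℂ] (K →ₗ[ℂ] K)) D = 0 :=
  operator_tensor_ext fun X Y => by simp

theorem mapTensor_zero_right (C : (H →ₗ[ℂ] H) →ₗ[ℂ] (K →ₗ[ℂ] K)) :
    mapTensor C (0 : (H' →ₗ[ℂ] H') →ₗ[ℂ] (K' →ₗ[ℂ] K')) = 0 :=
  operator_tensor_ext fun X Y => by simp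

theorem mapTensor_twoSided (M : H →ₗ[ℂ] K) (N : K →ₗ[ℂ] H) (M' : H' →ₗ[ℂ] K')
    (N' : K' →ₗ[ℂ] H') :
    mapTensor (twoSided M N) (twoSided M' N') =
      twoSided (TensorProduct.map M M') (TensorProduct.map N N') :=
  operator_tensor_ext fun X Y => by simp [TensorProduct.map_comp]

end MapTensor

/-! ### Hilbert-Schmidt adjoints -/

section Adjoint

variable {H K H' K' : Type*}
  [NormedAddCommGroup H] [InnerProductSpace ℂ H] [FiniteDimensional ℂ H]
  [NormedAddCommGroup K] [InnerProductSpace ℂ K] [FiniteDimensional ℂ K]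
  [NormedAddCommGroup H'] [InnerProductSpace ℂ H'] [FiniteDimensional ℂ H']
  [NormedAddCommGroup K'] [InnerProductSpace ℂ K'] [FiniteDimensional ℂ K']

theorem adjoint_twoSided (M : H →ₗ[ℂ] K) (N : K →ₗ[ℂ] H) :
    LinearMap.adjoint (twoSided M N) = twoSided (LinearMap.adjoint M) (LinearMap.adjoint N) := by
  symm
  rw [LinearMap.eq_adjoint_iff]
  intro X Y
  simp only [operator_inner_def, twoSided_apply, LinearMap.adjoint_comp, LinearMap.adjoint_adjoint,
    LinearMap.comp_assoc]
  rw [LinearMap.trace_comp_comm']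
  simp only [LinearMap.comp_assoc]

theorem operator_inner_map_map (X X' : H →ₗ[ℂ] H) (Y Y' : K →ₗ[ℂ] K) :
    inner ℂ (TensorProduct.map X Y) (TensorProduct.map X' Y') = inner ℂ X X' * inner ℂ Y Y' := by
  simp only [operator_inner_def, TensorProduct.adjoint_map, ← TensorProduct.map_comp,
    LinearMap.trace_tensorProduct']

theorem adjoint_mapTensor (C : (H →ₗ[ℂ] H) →ₗ[ℂ] (K →ₗ[ℂ] K))
    (D : (H' →ₗ[ℂ] H') →ₗ[ℂ] (K' →ₗ[ℂ] K')) :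
    LinearMap.adjoint (𝕜 := ℂ) (E := H ⊗[ℂ] H' →ₗ[ℂ] H ⊗[ℂ] H') (F := K ⊗[ℂ] K' →ₗ[ℂ] K ⊗[ℂ] K')
      (mapTensor C D) = mapTensor (LinearMap.adjoint C) (LinearMap.adjoint D) := by
  refine operator_tensor_ext fun X Y => ext_inner_right ℂ fun σ => ?_
  rw [LinearMap.adjoint_inner_left, mapTensor_map]
  have key : (innerₛₗ ℂ (TensorProduct.map X Y)) ∘ₗ mapTensor C D =
      innerₛₗ ℂ (TensorProduct.map (LinearMap.adjoint C X) (LinearMap.adjoint D Y)) :=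
    operator_tensor_ext fun X' Y' => by
      simp only [LinearMap.comp_apply, mapTensor_map, innerₛₗ_apply_apply]
      rw [operator_inner_map_map, operator_inner_map_map, LinearMap.adjoint_inner_left,
        LinearMap.adjoint_inner_left]
  exact LinearMap.congr_fun key σ

end Adjoint

/-! ### Kraus decompositions -/

section Kraus

/-- The map `x ↦ x ⊗ e`. -/
def tensorKet (K : Type*) {E : Type*} [AddCommGroup K] [Module ℂ K] [AddCommGroup E] [Module ℂ E]
    (e : E) : K →ₗ[ℂ] K ⊗[ℂ] E :=
  (TensorProduct.mk ℂ K E).flip e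

@[simp] theorem tensorKet_apply {K E : Type*} [AddCommGroup K] [Module ℂ K] [AddCommGroup E]
    [Module ℂ E] (e : E) (x : K) : tensorKet K e x = x ⊗ₜ e := rfl

variable {H K L H' K' E : Type*}
  [NormedAddCommGroup H] [InnerProductSpace ℂ H] [FiniteDimensional ℂ H]
  [NormedAddCommGroup K] [InnerProductSpace ℂ K] [FiniteDimensional ℂ K]
  [NormedAddCommGroup L] [InnerProductSpace ℂ L] [FiniteDimensional ℂ L]
  [NormedAddCommGroup H'] [InnerProductSpace ℂ H'] [FiniteDimensional ℂ H']
  [NormedAddCommGroup K'] [InnerProductSpace ℂ K'] [FiniteDimensional ℂ K']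
  [NormedAddCommGroup E] [InnerProductSpace ℂ E] [FiniteDimensional ℂ E]

@[simp] theorem adjoint_tensorKet_tmul (e y : E) (x : K) :
    LinearMap.adjoint (tensorKet K e) (x ⊗ₜ y) = inner ℂ e y • x := by
  refine ext_inner_left ℂ fun z => ?_
  rw [LinearMap.adjoint_inner_right, tensorKet_apply, TensorProduct.inner_tmul, inner_smul_right,
    mul_comm]

/-- The partial trace, computed in an orthonormal basis of the space that is traced out. -/
theorem partialTrace_eq_sum {ι : Type*} [Fintype ι] (b : OrthonormalBasis ι ℂ E) :
    partialTrace K E = ∑ i, twoSided (LinearMap.adjoint (tensorKet K (b i))) (tensorKet K (b i)) :=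
  operator_tensor_ext fun X Y => by
    refine LinearMap.ext fun x => ?_
    simp [partialTrace, homTensorHomEquiv_symm_map, LinearMap.trace_eq_sum_inner Y b,
      LinearMap.sum_apply, Finset.sum_smul]

/-- A map is completely positive if and only if it has a Kraus decomposition
`ρ ↦ ∑ i, M i ∘ ρ ∘ (M i)†`. -/
theorem isCompletelyPositive_iff_kraus {C : (H →ₗ[ℂ] H) →ₗ[ℂ] (K →ₗ[ℂ] K)} :
    IsCompletelyPositive C ↔ ∃ (ι : Type) (_ : Fintype ι) (M : ι → (H →ₗ[ℂ] K)),
      C = ∑ i, twoSided (M i) (LinearMap.adjoint (M i)) := by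
  constructor
  · rintro ⟨E, _, _, _, M, hM⟩
    refine ⟨_, inferInstance,
      fun i => LinearMap.adjoint (tensorKet K (stdOrthonormalBasis ℂ E i)) ∘ₗ M, ?_⟩
    refine LinearMap.ext fun ρ => ?_
    rw [hM, partialTrace_eq_sum (stdOrthonormalBasis ℂ E)]
    simp only [LinearMap.sum_apply, twoSided_apply, LinearMap.adjoint_comp,
      LinearMap.adjoint_adjoint, LinearMap.comp_assoc]
  · classical
    rintro ⟨ι, _, M, rfl⟩
    -- The environment has an orthonormal basis indexed by the Kraus operators.
    let b := EuclideanSpace.basisFun ι ℂ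
    let N : H →ₗ[ℂ] K ⊗[ℂ] EuclideanSpace ℂ ι := ∑ i, tensorKet K (b i) ∘ₗ M i
    have hN : ∀ j, LinearMap.adjoint (tensorKet K (b j)) ∘ₗ N = M j := fun j => by
      refine LinearMap.ext fun x => ?_
      simp [N, OrthonormalBasis.inner_eq_ite]
    refine ⟨EuclideanSpace ℂ ι, inferInstance, inferInstance, inferInstance, N, fun ρ => ?_⟩
    rw [partialTrace_eq_sum b]
    simp only [LinearMap.sum_apply]
    refine Finset.sum_congr rfl fun i _ => ?_
    rw [← hN i]
    simp only [twoSided_apply, LinearMap.adjoint_comp, LinearMap.adjoint_adjoint,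
      LinearMap.comp_assoc]

theorem isCompletelyPositive_twoSided (M : H →ₗ[ℂ] K) :
    IsCompletelyPositive (twoSided M (LinearMap.adjoint M)) :=
  isCompletelyPositive_iff_kraus.2 ⟨Unit, inferInstance, fun _ => M, by simp⟩

theorem IsCompletelyPositive.comp {C : (H →ₗ[ℂ] H) →ₗ[ℂ] (K →ₗ[ℂ] K)}
    {D : (K →ₗ[ℂ] K) →ₗ[ℂ] (L →ₗ[ℂ] L)} (hD : IsCompletelyPositive D)
    (hC : IsCompletelyPositive C) : IsCompletelyPositive (D ∘ₗ C) := by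
  obtain ⟨ι, _, M, rfl⟩ := isCompletelyPositive_iff_kraus.1 hC
  obtain ⟨κ, _, N, rfl⟩ := isCompletelyPositive_iff_kraus.1 hD
  refine isCompletelyPositive_iff_kraus.2 ⟨κ × ι, inferInstance, fun p => N p.1 ∘ₗ M p.2, ?_⟩
  rw [Fintype.sum_prod_type]
  simp only [LinearMap.adjoint_comp, ← twoSided_comp_twoSided]
  refine LinearMap.ext fun ρ => ?_
  simp only [LinearMap.comp_apply, LinearMap.sum_apply, map_sum]
  exact Finset.sum_comm

theorem IsCompletelyPositive.tensor {C : (H →ₗ[ℂ] H) →ₗ[ℂ] (K →ₗ[ℂ] K)}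
    {D : (H' →ₗ[ℂ] H') →ₗ[ℂ] (K' →ₗ[ℂ] K')} (hC : IsCompletelyPositive C)
    (hD : IsCompletelyPositive D) : IsCompletelyPositive (mapTensor C D) := by
  obtain ⟨ι, _, M, rfl⟩ := isCompletelyPositive_iff_kraus.1 hC
  obtain ⟨κ, _, N, rfl⟩ := isCompletelyPositive_iff_kraus.1 hD
  refine isCompletelyPositive_iff_kraus.2
    ⟨ι × κ, inferInstance, fun p => TensorProduct.map (M p.1) (N p.2), ?_⟩
  rw [Fintype.sum_prod_type]
  simp only [TensorProduct.adjoint_map, ← mapTensor_twoSided]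
  refine operator_tensor_ext fun X Y => ?_
  simp only [mapTensor_map, LinearMap.sum_apply]
  simp only [← TensorProduct.mapBilinear_apply, map_sum, LinearMap.sum_apply]
  exact Finset.sum_comm

theorem IsCompletelyPositive.adjoint {C : (H →ₗ[ℂ] H) →ₗ[ℂ] (K →ₗ[ℂ] K)}
    (hC : IsCompletelyPositive C) : IsCompletelyPositive (LinearMap.adjoint C) := by
  obtain ⟨ι, _, M, rfl⟩ := isCompletelyPositive_iff_kraus.1 hC
  refine isCompletelyPositive_iff_kraus.2 ⟨ι, inferInstance, fun i => LinearMap.adjoint (M i), ?_⟩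
  simp only [map_sum, adjoint_twoSided]

end Kraus

/-! ### Maps that follow a route -/

namespace PartitionedSpace

theorem sum_proj_apply (A : PartitionedSpace) (x : A.space) : ∑ k, A.proj k x = x := by
  simpa using LinearMap.congr_fun A.sum_proj x

/-- A map follows a route if and only if its blocks outside of the route vanish. -/
theorem follows_iff {A B : PartitionedSpace} {r : SetRel A.index B.index}
    {f : A.space →ₗ[ℂ] B.space} :
    A.Follows B r f ↔ ∀ k l, (k, l) ∉ r → B.proj l ∘ₗ f ∘ₗ A.proj k = 0 := by
  classical
  constructor
  · intro h k l hkl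
    rw [h]
    refine LinearMap.ext fun x => ?_
    simp only [LinearMap.comp_apply, LinearMap.sum_apply, map_sum, LinearMap.zero_apply]
    refine Finset.sum_eq_zero fun k' _ => Finset.sum_eq_zero fun l' _ => ?_
    split_ifs with h'
    · by_cases hk : k' = k
      · have hl : l ≠ l' := by rintro rfl; exact hkl (hk ▸ h')
        exact LinearMap.congr_fun (B.proj_orthogonal l l' hl) _
      · have := LinearMap.congr_fun (A.proj_orthogonal k' k hk) x
        simp only [LinearMap.comp_apply, LinearMap.zero_apply] at this
        simp only [LinearMap.comp_apply, this, map_zero]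
    · simp
  · intro h
    have hsum : f = ∑ k, ∑ l, B.proj l ∘ₗ f ∘ₗ A.proj k := by
      refine LinearMap.ext fun x => ?_
      simp only [LinearMap.sum_apply, LinearMap.comp_apply, sum_proj_apply, ← map_sum]
    rw [Follows]
    nth_rewrite 1 [hsum]
    refine Finset.sum_congr rfl fun k _ => Finset.sum_congr rfl fun l _ => ?_
    split_ifs with h'
    · rfl
    · exact h k l h'

theorem Follows.comp {A B C : PartitionedSpace} {r : SetRel A.index B.index}
    {s : SetRel B.index C.index} {f : A.space →ₗ[ℂ] B.space} {g : B.space →ₗ[ℂ] C.space}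
    (hg : B.Follows C s g) (hf : A.Follows B r f) : A.Follows C (r.comp s) (g ∘ₗ f) := by
  rw [follows_iff] at hf hg ⊢
  intro k m hkm
  refine LinearMap.ext fun x => ?_
  simp only [LinearMap.comp_apply, LinearMap.zero_apply]
  rw [← B.sum_proj_apply (f (A.proj k x)), map_sum, map_sum]
  refine Finset.sum_eq_zero fun l _ => ?_
  -- Each intermediate sector `l` is excluded by one of the two routes.
  by_cases hkl : (k, l) ∈ r
  · exact LinearMap.congr_fun (hg l m fun hlm => hkm ⟨l, hkl, hlm⟩) (f (A.proj k x))
  · have := LinearMap.congr_fun (hf k l hkl) x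
    simp only [LinearMap.comp_apply, LinearMap.zero_apply] at this
    rw [this, map_zero, map_zero]

theorem Follows.adjoint {A B : PartitionedSpace} {r : SetRel A.index B.index}
    {f : A.space →ₗ[ℂ] B.space} (hf : A.Follows B r f) :
    B.Follows A r.inv (LinearMap.adjoint f) := by
  rw [follows_iff] at hf ⊢
  intro l k hlk
  have hA : LinearMap.adjoint (A.proj k) = A.proj k :=
    ((LinearMap.eq_adjoint_iff _ _).2 (A.proj_symmetric k)).symm
  have hB : LinearMap.adjoint (B.proj l) = B.proj l :=
    ((LinearMap.eq_adjoint_iff _ _).2 (B.proj_symmetric l)).symm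
  have h := congrArg LinearMap.adjoint (hf k l hlk)
  rwa [LinearMap.adjoint_comp, LinearMap.adjoint_comp, hA, hB, map_zero,
    LinearMap.comp_assoc] at h

theorem sandwich_eq_twoSided (A : PartitionedSpace) (p : A.index × A.index) :
    A.sandwich p = twoSided (A.proj p.1) (A.proj p.2) := rfl

theorem sandwich_tensor (A B : PartitionedSpace) (k k' : A.index) (l l' : B.index) :
    (A.tensor B).sandwich ((k, l), (k', l')) =
      mapTensor (A.sandwich (k, k')) (B.sandwich (l, l')) := by
  simp only [sandwich_eq_twoSided, mapTensor_twoSided]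

theorem Follows.tensor {A B A' B' : PartitionedSpace}
    {r : SetRel (A.index × A.index) (B.index × B.index)}
    {r' : SetRel (A'.index × A'.index) (B'.index × B'.index)}
    {f : A.operators.space →ₗ[ℂ] B.operators.space}
    {g : A'.operators.space →ₗ[ℂ] B'.operators.space}
    (hf : A.operators.Follows B.operators r f) (hg : A'.operators.Follows B'.operators r' g) :
    (A.tensor A').operators.Follows (B.tensor B').operators (routeProd r r') (mapTensor f g) := by
  rw [follows_iff] at hf hg ⊢
  rintro ⟨⟨k, l⟩, ⟨k', l'⟩⟩ ⟨⟨m, n⟩, ⟨m', n'⟩⟩ h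
  change (B.tensor B').sandwich _ ∘ₗ mapTensor f g ∘ₗ (A.tensor A').sandwich _ = 0
  rw [sandwich_tensor, sandwich_tensor, ← mapTensor_comp, ← mapTensor_comp]
  by_cases h1 : ((k, k'), (m, m')) ∈ r
  · have h2 : ((l, l'), (n, n')) ∉ r' := fun h2 => h ⟨h1, h2⟩
    have := hg _ _ h2
    change B'.sandwich _ ∘ₗ g ∘ₗ A'.sandwich _ = 0 at this
    rw [this, mapTensor_zero_right]
  · have := hf _ _ h1
    change B.sandwich _ ∘ₗ f ∘ₗ A.sandwich _ = 0 at this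
    rw [this, mapTensor_zero_left]

end PartitionedSpace

/-! ### Completely positive relations -/

theorem IsCompletelyPositiveRel.comp {Z W V : Type*} {Λ : SetRel (Z × Z) (W × W)}
    {Γ : SetRel (W × W) (V × V)} (hΛ : IsCompletelyPositiveRel Λ)
    (hΓ : IsCompletelyPositiveRel Γ) : IsCompletelyPositiveRel (Λ.comp Γ) := by
  obtain ⟨E, r, hr⟩ := hΛ
  obtain ⟨F, s, hs⟩ := hΓ
  refine ⟨E × F, {p | ∃ w, (p.1, (w, p.2.2.1)) ∈ r ∧ (w, (p.2.1, p.2.2.2)) ∈ s},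
    fun k k' l l' => ?_⟩
  simp only [SetRel.mem_comp, Prod.exists, hr, hs, Set.mem_ofPred_eq]
  constructor
  · rintro ⟨w, w', ⟨m, h1, h2⟩, n, h3, h4⟩
    exact ⟨m, n, ⟨w, h1, h3⟩, ⟨w', h2, h4⟩⟩
  · rintro ⟨m, n, ⟨w, h1, h3⟩, ⟨w', h2, h4⟩⟩
    exact ⟨w, w', ⟨m, h1, h2⟩, n, h3, h4⟩

theorem IsCompletelyPositiveRel.routeProd {Z W Z' W' : Type*} {Λ : SetRel (Z × Z) (W × W)}
    {Λ' : SetRel (Z' × Z') (W' × W')} (hΛ : IsCompletelyPositiveRel Λ)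
    (hΛ' : IsCompletelyPositiveRel Λ') : IsCompletelyPositiveRel (routeProd Λ Λ') := by
  obtain ⟨E, r, hr⟩ := hΛ
  obtain ⟨F, s, hs⟩ := hΛ'
  refine ⟨E × F, {p | (p.1.1, (p.2.1.1, p.2.2.1)) ∈ r ∧ (p.1.2, (p.2.1.2, p.2.2.2)) ∈ s},
    fun k k' l l' => ?_⟩
  simp only [Routed.routeProd, Set.mem_ofPred_eq, hr, hs, Prod.exists]
  constructor
  · rintro ⟨⟨m, h1, h2⟩, n, h3, h4⟩
    exact ⟨m, n, ⟨h1, h3⟩, h2, h4⟩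
  · rintro ⟨m, n, ⟨h1, h3⟩, h2, h4⟩
    exact ⟨⟨m, h1, h2⟩, n, h3, h4⟩

theorem IsCompletelyPositiveRel.inv {Z W : Type*} {Λ : SetRel (Z × Z) (W × W)}
    (hΛ : IsCompletelyPositiveRel Λ) : IsCompletelyPositiveRel Λ.inv := by
  obtain ⟨E, r, hr⟩ := hΛ
  exact ⟨E, {p | (p.2.1, (p.1, p.2.2)) ∈ r}, fun l l' k k' => hr k k' l l'⟩

/-- The route that relates `(k, k')` to `(e k, e k')` only. -/
def inducedRoute {Z W : Type*} (e : Z → W) : SetRel (Z × Z) (W × W) :=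
  {p | p.2 = (e p.1.1, e p.1.2)}

@[simp] theorem mem_inducedRoute {Z W : Type*} {e : Z → W} {p : (Z × Z) × (W × W)} :
    p ∈ inducedRoute e ↔ p.2 = (e p.1.1, e p.1.2) := Iff.rfl

theorem isCompletelyPositiveRel_inducedRoute {Z W : Type*} (e : Z → W) :
    IsCompletelyPositiveRel (inducedRoute e) :=
  ⟨Unit, {p | p.2.1 = e p.1}, fun k k' l l' => by simp⟩

theorem inducedRoute_comp_inducedRoute {Z W V : Type*} (e : Z → W) (e' : W → V) :
    (inducedRoute e).comp (inducedRoute e') = inducedRoute (e' ∘ e) := by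
  ext ⟨⟨k, k'⟩, ⟨l, l'⟩⟩
  simp [SetRel.comp]

theorem inducedRoute_id {Z : Type*} : inducedRoute (id : Z → Z) = SetRel.id := by
  ext ⟨⟨k, k'⟩, ⟨l, l'⟩⟩
  simp [eq_comm]

theorem routeProd_inducedRoute {Z W Z' W' : Type*} (e : Z → W) (e' : Z' → W') :
    routeProd (inducedRoute e) (inducedRoute e') = inducedRoute (Prod.map e e') := by
  ext ⟨⟨⟨k, l⟩, ⟨k', l'⟩⟩, ⟨⟨m, n⟩, ⟨m', n'⟩⟩⟩
  simp only [routeProd, Set.mem_ofPred_eq, mem_inducedRoute, Prod.map_apply, Prod.mk.injEq]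
  tauto

theorem routeProd_comp {Z W V Z' W' V' : Type*} (Λ : SetRel (Z × Z) (W × W))
    (Γ : SetRel (W × W) (V × V)) (Λ' : SetRel (Z' × Z') (W' × W'))
    (Γ' : SetRel (W' × W') (V' × V')) :
    routeProd (Λ.comp Γ) (Λ'.comp Γ') = (routeProd Λ Λ').comp (routeProd Γ Γ') := by
  ext ⟨⟨⟨k, l⟩, ⟨k', l'⟩⟩, ⟨⟨m, n⟩, ⟨m', n'⟩⟩⟩
  simp only [routeProd, SetRel.comp, Set.mem_ofPred_eq, Prod.exists]
  constructor
  · rintro ⟨⟨a, a', h1, h2⟩, b, b', h3, h4⟩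
    exact ⟨a, b, a', b', ⟨h1, h3⟩, h2, h4⟩
  · rintro ⟨a, b, a', b', ⟨h1, h3⟩, h2, h4⟩
    exact ⟨⟨a, a', h1, h2⟩, b, b', h3, h4⟩

theorem inducedRoute_inv {Z W : Type*} (e : Z ≃ W) :
    (inducedRoute e).inv = inducedRoute e.symm := by
  ext ⟨⟨k, k'⟩, ⟨l, l'⟩⟩
  simp [SetRel.inv, Equiv.eq_symm_apply, eq_comm]

/-! ### Isomorphisms of partitioned spaces -/

namespace PartitionedSpace

/-- A unitary `U : H_A → H_B` together with a bijection `e : Z_A → Z_B` such that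
`U ∘ π_A^k = π_B^{e k} ∘ U`. -/
@[ext]
structure UnitaryIso (A B : PartitionedSpace) where
  unitary : A.space ≃ₗᵢ[ℂ] B.space
  indexEquiv : A.index ≃ B.index
  map_proj : ∀ k x, unitary (A.proj k x) = B.proj (indexEquiv k) (unitary x)

namespace UnitaryIso

variable {A B C A' B' : PartitionedSpace}

/-- The identity. -/
@[simps] def refl (A : PartitionedSpace) : UnitaryIso A A where
  unitary := .refl ℂ A.space
  indexEquiv := .refl A.index
  map_proj _ _ := rfl

/-- The composite. -/
@[simps] def trans (U : UnitaryIso A B) (V : UnitaryIso B C) : UnitaryIso A C where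
  unitary := U.unitary.trans V.unitary
  indexEquiv := U.indexEquiv.trans V.indexEquiv
  map_proj k x := by simp [U.map_proj, V.map_proj]

/-- The inverse. -/
@[simps] def symm (U : UnitaryIso A B) : UnitaryIso B A where
  unitary := U.unitary.symm
  indexEquiv := U.indexEquiv.symm
  map_proj k x := by
    rw [LinearIsometryEquiv.symm_apply_eq, U.map_proj]
    simp

/-- The tensor product. -/
@[simps] def tensor (U : UnitaryIso A B) (V : UnitaryIso A' B') :
    UnitaryIso (A.tensor A') (B.tensor B') where
  unitary := TensorProduct.congrIsometry U.unitary V.unitary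
  indexEquiv := U.indexEquiv.prodCongr V.indexEquiv
  map_proj k x := by
    induction x using TensorProduct.induction_on with
    | zero => simp only [map_zero]
    | add x y hx hy => simp only [map_add, hx, hy]
    | tmul a b => simp [U.map_proj, V.map_proj]

/-- The canonical isomorphism `(A ⊗ B) ⊗ C ≅ A ⊗ (B ⊗ C)`. -/
@[simps] def assoc (A B C : PartitionedSpace) :
    UnitaryIso ((A.tensor B).tensor C) (A.tensor (B.tensor C)) where
  unitary := TensorProduct.assocIsometry ℂ A.space B.space C.space
  indexEquiv := .prodAssoc A.index B.index C.index
  map_proj k x := by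
    obtain ⟨⟨k, l⟩, m⟩ := k
    refine LinearMap.congr_fun (f := (TensorProduct.assoc ℂ A.space B.space C.space).toLinearMap ∘ₗ
      TensorProduct.map (TensorProduct.map (A.proj k) (B.proj l)) (C.proj m))
      (g := TensorProduct.map (A.proj k) (TensorProduct.map (B.proj l) (C.proj m)) ∘ₗ
        (TensorProduct.assoc ℂ A.space B.space C.space).toLinearMap)
      (TensorProduct.ext_threefold fun a b c => ?_) x
    simp

/-- The canonical isomorphism `ℂ ⊗ A ≅ A`. -/
@[simps] def leftUnitor (A : PartitionedSpace) : UnitaryIso (unit.tensor A) A where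
  unitary := TensorProduct.lidIsometry ℂ A.space
  indexEquiv := .punitProd A.index
  map_proj k x := by
    induction x using TensorProduct.induction_on with
    | zero => simp only [map_zero]
    | add x y hx hy => simp only [map_add, hx, hy]
    | tmul a b => simp

/-- The canonical isomorphism `A ⊗ ℂ ≅ A`. -/
@[simps] def rightUnitor (A : PartitionedSpace) : UnitaryIso (A.tensor unit) A where
  unitary := TensorProduct.ridIsometry ℂ A.space
  indexEquiv := .prodPUnit A.index
  map_proj k x := by
    induction x using TensorProduct.induction_on with
    | zero => simp only [map_zero]
    | add x y hx hy => simp only [map_add, hx, hy]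
    | tmul a b => simp

/-- The swap `A ⊗ B ≅ B ⊗ A`. -/
@[simps] def comm (A B : PartitionedSpace) : UnitaryIso (A.tensor B) (B.tensor A) where
  unitary := TensorProduct.commIsometry ℂ A.space B.space
  indexEquiv := .prodComm A.index B.index
  map_proj k x := by
    induction x using TensorProduct.induction_on with
    | zero => simp only [map_zero]
    | add x y hx hy => simp only [map_add, hx, hy]
    | tmul a b => simp

theorem ext_of_toLinearMap {U V : UnitaryIso A B}
    (h : U.unitary.toLinearEquiv.toLinearMap = V.unitary.toLinearEquiv.toLinearMap)
    (h' : ∀ k, U.indexEquiv k = V.indexEquiv k) : U = V :=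
  UnitaryIso.ext (LinearIsometryEquiv.ext fun x => LinearMap.congr_fun h x) (Equiv.ext h')

theorem adjoint_unitary (U : UnitaryIso A B) :
    LinearMap.adjoint U.unitary.toLinearEquiv.toLinearMap =
      U.symm.unitary.toLinearEquiv.toLinearMap := by
  symm
  rw [LinearMap.eq_adjoint_iff]
  intro x y
  change inner ℂ (U.unitary.symm x) y = inner ℂ x (U.unitary y)
  rw [← U.unitary.inner_map_map, U.unitary.apply_symm_apply]

/-- The map `ρ ↦ U ∘ ρ ∘ U⁻¹`. -/
def conj (U : UnitaryIso A B) : (A.space →ₗ[ℂ] A.space) →ₗ[ℂ] (B.space →ₗ[ℂ] B.space) :=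
  twoSided U.unitary.toLinearEquiv.toLinearMap U.symm.unitary.toLinearEquiv.toLinearMap

theorem isCompletelyPositive_conj (U : UnitaryIso A B) : IsCompletelyPositive U.conj := by
  rw [conj, ← adjoint_unitary]
  exact isCompletelyPositive_twoSided _

theorem follows_conj (U : UnitaryIso A B) :
    A.operators.Follows B.operators (inducedRoute U.indexEquiv) U.conj := by
  rw [follows_iff]
  rintro ⟨k, k'⟩ ⟨l, l'⟩ h
  refine LinearMap.ext fun ρ => LinearMap.ext fun x => ?_
  change B.proj l (U.unitary (A.proj k (ρ (A.proj k' (U.symm.unitary (B.proj l' x)))))) = 0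
  rw [U.map_proj, U.symm.map_proj]
  by_cases hl : l = U.indexEquiv k
  · have hl' : k' ≠ U.symm.indexEquiv l' := by
      rintro rfl
      exact h (by simp [hl])
    have := LinearMap.congr_fun (A.proj_orthogonal _ _ hl') (U.symm.unitary x)
    simp only [LinearMap.comp_apply, LinearMap.zero_apply] at this
    rw [this, map_zero, map_zero, map_zero, map_zero]
  · exact LinearMap.congr_fun (B.proj_orthogonal _ _ hl) _

end UnitaryIso

end PartitionedSpace

/-! ### Operations on routed maps -/

open PartitionedSpace

namespace RoutedCPM

variable {A B C A' B' C' : OperatorSpace}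

/-- Sequential composition, in diagrammatic order. -/
@[simps] def comp (f : RoutedCPM A B) (g : RoutedCPM B C) : RoutedCPM A C where
  route := f.route.comp g.route
  map := g.map ∘ₗ f.map
  route_cp := f.route_cp.comp g.route_cp
  map_cp := g.map_cp.comp f.map_cp
  follows := g.follows.comp f.follows

/-- Parallel composition. -/
@[simps] def tensor (f : RoutedCPM A B) (g : RoutedCPM A' B') :
    RoutedCPM (A.tensor A') (B.tensor B') where
  route := routeProd f.route g.route
  map := mapTensor f.map g.map
  route_cp := f.route_cp.routeProd g.route_cp
  map_cp := f.map_cp.tensor g.map_cp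
  follows := f.follows.tensor g.follows

/-- The dagger: the opposite route with the Hilbert-Schmidt adjoint. -/
@[simps] def adjoint (f : RoutedCPM A B) : RoutedCPM B A where
  route := f.route.inv
  map := LinearMap.adjoint f.map
  route_cp := f.route_cp.inv
  map_cp := f.map_cp.adjoint
  follows := f.follows.adjoint

/-- The routed map `ρ ↦ U ∘ ρ ∘ U⁻¹` of an isomorphism of partitioned spaces. -/
@[simps] def induced (U : UnitaryIso A.base B.base) : RoutedCPM A B where
  route := inducedRoute U.indexEquiv
  map := U.conj
  route_cp := isCompletelyPositiveRel_inducedRoute _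
  map_cp := U.isCompletelyPositive_conj
  follows := U.follows_conj

theorem induced_comp_induced (U : UnitaryIso A.base B.base) (V : UnitaryIso B.base C.base) :
    (induced U).comp (induced V) = induced (U.trans V) :=
  RoutedCPM.ext (inducedRoute_comp_inducedRoute _ _) rfl

theorem induced_tensor_induced (U : UnitaryIso A.base B.base) (V : UnitaryIso A'.base B'.base) :
    (induced U).tensor (induced V) =
      induced (A := A.tensor A') (B := B.tensor B') (U.tensor V) :=
  RoutedCPM.ext (routeProd_inducedRoute _ _) (mapTensor_twoSided _ _ _ _)

theorem induced_adjoint (U : UnitaryIso A.base B.base) : (induced U).adjoint = induced U.symm :=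
  RoutedCPM.ext (inducedRoute_inv _) <| by
    change LinearMap.adjoint U.conj = U.symm.conj
    rw [UnitaryIso.conj, adjoint_twoSided, UnitaryIso.adjoint_unitary, UnitaryIso.adjoint_unitary]
    rfl

theorem induced_comp_induced_symm (U : UnitaryIso A.base B.base) :
    (induced U).comp (induced U.symm) = induced (UnitaryIso.refl A.base) := by
  rw [induced_comp_induced]
  congr 1
  exact UnitaryIso.ext (by simp) (by simp)

theorem induced_symm_comp_induced (U : UnitaryIso A.base B.base) :
    (induced U.symm).comp (induced U) = induced (UnitaryIso.refl B.base) := by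
  rw [induced_comp_induced]
  congr 1
  exact UnitaryIso.ext (by simp) (by simp)

theorem induced_refl_comp (f : RoutedCPM A B) : (induced (UnitaryIso.refl A.base)).comp f = f :=
  RoutedCPM.ext
    ((congrArg (SetRel.comp · f.route) inducedRoute_id).trans (SetRel.id_comp f.route)) rfl

theorem comp_induced_refl (f : RoutedCPM A B) : f.comp (induced (UnitaryIso.refl B.base)) = f :=
  RoutedCPM.ext ((congrArg (f.route.comp ·) inducedRoute_id).trans (SetRel.comp_id f.route)) rfl

theorem comp_assoc {D : OperatorSpace} (f : RoutedCPM A B) (g : RoutedCPM B C)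
    (h : RoutedCPM C D) : (f.comp g).comp h = f.comp (g.comp h) :=
  RoutedCPM.ext (SetRel.comp_assoc _ _ _) rfl

theorem tensor_comp_tensor (f : RoutedCPM A B) (f' : RoutedCPM A' B') (g : RoutedCPM B C)
    (g' : RoutedCPM B' C') :
    (f.tensor f').comp (g.tensor g') = (f.comp g).tensor (f'.comp g') :=
  RoutedCPM.ext (routeProd_comp _ _ _ _).symm (mapTensor_comp _ _ _ _).symm

theorem adjoint_comp (f : RoutedCPM A B) (g : RoutedCPM B C) :
    (f.comp g).adjoint = g.adjoint.comp f.adjoint :=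
  RoutedCPM.ext (SetRel.inv_comp _ _) (LinearMap.adjoint_comp _ _)

theorem adjoint_adjoint (f : RoutedCPM A B) : f.adjoint.adjoint = f :=
  RoutedCPM.ext rfl (LinearMap.adjoint_adjoint _)

theorem adjoint_tensor (f : RoutedCPM A B) (g : RoutedCPM A' B') :
    (f.tensor g).adjoint = f.adjoint.tensor g.adjoint :=
  RoutedCPM.ext rfl (adjoint_mapTensor _ _)

/-! ### Naturality of the structural isomorphisms -/

theorem tensor_comp_assoc (f : RoutedCPM A A') (g : RoutedCPM B B') (h : RoutedCPM C C') :
    ((f.tensor g).tensor h).comp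
        (induced (B := A'.tensor (B'.tensor C')) (UnitaryIso.assoc A'.base B'.base C'.base)) =
      (induced (A := (A.tensor B).tensor C) (UnitaryIso.assoc A.base B.base C.base)).comp
        (f.tensor (g.tensor h)) := by
  refine RoutedCPM.ext ?_ ?_
  · ext ⟨⟨⟨⟨a, b⟩, c⟩, ⟨⟨a', b'⟩, c'⟩⟩, ⟨⟨x, ⟨y, z⟩⟩, ⟨x', ⟨y', z'⟩⟩⟩⟩
    simp [routeProd, SetRel.comp, and_assoc]
  · refine operator_tensor_ext_threefold fun X Y Z => ?_
    have key {A B C : PartitionedSpace} (X : A.space →ₗ[ℂ] A.space) (Y : B.space →ₗ[ℂ] B.space)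
        (Z : C.space →ₗ[ℂ] C.space) :
        (UnitaryIso.assoc A B C).conj (TensorProduct.map (TensorProduct.map X Y) Z) =
          TensorProduct.map X (TensorProduct.map Y Z) := by
      refine TensorProduct.ext' fun a t => ?_
      induction t using TensorProduct.induction_on with
      | zero => simp only [TensorProduct.tmul_zero, map_zero]
      | add s t hs ht => simp only [TensorProduct.tmul_add, map_add, hs, ht]
      | tmul b c => simp [UnitaryIso.conj]
    simp [key]

theorem tensor_comp_leftUnitor (f : RoutedCPM A B) :
    ((induced (A := OperatorSpace.unit) (B := OperatorSpace.unit) (UnitaryIso.refl unit)).tensor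
        f).comp (induced (UnitaryIso.leftUnitor B.base)) =
      (induced (A := OperatorSpace.unit.tensor A) (UnitaryIso.leftUnitor A.base)).comp f := by
  refine RoutedCPM.ext ?_ ?_
  · ext ⟨⟨⟨⟨⟩, a⟩, ⟨⟨⟩, a'⟩⟩, ⟨x, x'⟩⟩
    simp [routeProd, SetRel.comp]
  · refine operator_tensor_ext fun X Y => ?_
    -- An operator on `ℂ` is the scalar by which it multiplies.
    have key {A : PartitionedSpace} (Y : A.space →ₗ[ℂ] A.space) :
        (UnitaryIso.leftUnitor A).conj (TensorProduct.map X Y) = X 1 • Y := by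
      refine LinearMap.ext fun x => ?_
      simp [UnitaryIso.conj]
    have hX : (UnitaryIso.refl unit).conj X = X := rfl
    simp [key, hX]

theorem tensor_comp_rightUnitor (f : RoutedCPM A B) :
    (f.tensor (induced (A := OperatorSpace.unit) (B := OperatorSpace.unit)
        (UnitaryIso.refl unit))).comp (induced (UnitaryIso.rightUnitor B.base)) =
      (induced (A := A.tensor OperatorSpace.unit) (UnitaryIso.rightUnitor A.base)).comp f := by
  refine RoutedCPM.ext ?_ ?_
  · ext ⟨⟨⟨a, ⟨⟩⟩, ⟨a', ⟨⟩⟩⟩, ⟨x, x'⟩⟩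
    simp [routeProd, SetRel.comp]
  · refine operator_tensor_ext fun Y X => ?_
    -- An operator on `ℂ` is the scalar by which it multiplies.
    have key {A : PartitionedSpace} (Y : A.space →ₗ[ℂ] A.space) :
        (UnitaryIso.rightUnitor A).conj (TensorProduct.map Y X) = X 1 • Y := by
      refine LinearMap.ext fun x => ?_
      simp [UnitaryIso.conj]
    have hX : (UnitaryIso.refl unit).conj X = X := rfl
    simp [key, hX]

theorem tensor_comp_comm (f : RoutedCPM A A') (g : RoutedCPM B B') :
    (f.tensor g).comp (induced (B := B'.tensor A') (UnitaryIso.comm A'.base B'.base)) =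
      (induced (A := A.tensor B) (UnitaryIso.comm A.base B.base)).comp (g.tensor f) := by
  refine RoutedCPM.ext ?_ ?_
  · ext ⟨⟨⟨a, b⟩, ⟨a', b'⟩⟩, ⟨⟨x, y⟩, ⟨x', y'⟩⟩⟩
    simp only [tensor_route, comp_route, induced_route, routeProd, SetRel.comp, mem_inducedRoute,
      Set.mem_ofPred_eq, Prod.exists, UnitaryIso.comm_indexEquiv, Equiv.prodComm_apply,
      Prod.swap_prod_mk, Prod.mk.injEq]
    constructor
    · rintro ⟨_, _, _, _, ⟨hf, hg⟩, ⟨rfl, rfl⟩, rfl, rfl⟩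
      exact ⟨b, a, b', a', ⟨⟨rfl, rfl⟩, rfl, rfl⟩, hg, hf⟩
    · rintro ⟨_, _, _, _, ⟨⟨rfl, rfl⟩, rfl, rfl⟩, hg, hf⟩
      exact ⟨y, x, y', x', ⟨hf, hg⟩, ⟨rfl, rfl⟩, rfl, rfl⟩
  · refine operator_tensor_ext fun X Y => ?_
    have key {A B : PartitionedSpace} (X : A.space →ₗ[ℂ] A.space) (Y : B.space →ₗ[ℂ] B.space) :
        (UnitaryIso.comm A B).conj (TensorProduct.map X Y) = TensorProduct.map Y X :=
      TensorProduct.ext' fun a b => by simp [UnitaryIso.conj]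
    simp [key]

end RoutedCPM

/-! ### The dagger symmetric monoidal structure -/

/-- The category of routed completely positive maps. -/
instance operatorSpaceCategory : Category.{0} OperatorSpace where
  Hom := RoutedCPM
  id A := RoutedCPM.induced (UnitaryIso.refl A.base)
  comp f g := f.comp g
  id_comp := RoutedCPM.induced_refl_comp
  comp_id := RoutedCPM.comp_induced_refl
  assoc := RoutedCPM.comp_assoc

/-- An isomorphism of partitioned spaces, as an isomorphism of the category of routed maps. -/
@[simps] def inducedIso {A B : OperatorSpace} (U : UnitaryIso A.base B.base) : A ≅ B where
  hom := RoutedCPM.induced U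
  inv := RoutedCPM.induced U.symm
  hom_inv_id := RoutedCPM.induced_comp_induced_symm U
  inv_hom_id := RoutedCPM.induced_symm_comp_induced U

/-- The tensor product of routed maps; whiskering is the tensor product with an identity, and the
structural morphisms are induced by the canonical unitaries. -/
instance operatorSpaceMonoidalStruct : MonoidalCategoryStruct OperatorSpace where
  tensorObj := OperatorSpace.tensor
  tensorHom f g := f.tensor g
  whiskerLeft X _ _ f := (RoutedCPM.induced (UnitaryIso.refl X.base)).tensor f
  whiskerRight f Y := RoutedCPM.tensor f (RoutedCPM.induced (UnitaryIso.refl Y.base))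
  tensorUnit := OperatorSpace.unit
  associator A B C := inducedIso (UnitaryIso.assoc A.base B.base C.base)
  leftUnitor A := inducedIso (UnitaryIso.leftUnitor A.base)
  rightUnitor A := inducedIso (UnitaryIso.rightUnitor A.base)

/-- The coherence laws are checked on the unitaries and the bijections of indices: an equation
between induced maps holds if the isomorphisms agree. -/
theorem induced_congr {A B : OperatorSpace} {U V : UnitaryIso A.base B.base}
    (h : U.unitary.toLinearEquiv.toLinearMap = V.unitary.toLinearEquiv.toLinearMap)
    (h' : ∀ k, U.indexEquiv k = V.indexEquiv k) :
    (RoutedCPM.induced U : RoutedCPM A B) = RoutedCPM.induced V :=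
  congrArg _ (UnitaryIso.ext_of_toLinearMap h h')

instance operatorSpaceMonoidalCategory : MonoidalCategory OperatorSpace :=
  MonoidalCategory.ofTensorHom
    (id_tensorHom_id := fun A B => (RoutedCPM.induced_tensor_induced _ _).trans <|
      induced_congr (A := A.tensor B) (B := A.tensor B)
        (TensorProduct.ext' fun _ _ => rfl) fun _ => rfl)
    (id_tensorHom := fun _ _ _ _ => rfl)
    (tensorHom_id := fun _ _ => rfl)
    (tensorHom_comp_tensorHom := fun f f' g g' => RoutedCPM.tensor_comp_tensor f f' g g')
    (associator_naturality := RoutedCPM.tensor_comp_assoc)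
    (leftUnitor_naturality := RoutedCPM.tensor_comp_leftUnitor)
    (rightUnitor_naturality := RoutedCPM.tensor_comp_rightUnitor)
    (pentagon := fun A B C D => by
      change ((RoutedCPM.induced _).tensor (RoutedCPM.induced _)).comp
        ((RoutedCPM.induced _).comp ((RoutedCPM.induced _).tensor (RoutedCPM.induced _))) =
          (RoutedCPM.induced _).comp (RoutedCPM.induced _)
      simp only [RoutedCPM.induced_tensor_induced, RoutedCPM.induced_comp_induced]
      exact induced_congr (TensorProduct.ext_fourfold fun _ _ _ _ => rfl) fun _ => rfl)
    (triangle := fun A B => by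
      change (RoutedCPM.induced _).comp ((RoutedCPM.induced _).tensor (RoutedCPM.induced _)) =
          (RoutedCPM.induced _).tensor (RoutedCPM.induced _)
      simp only [RoutedCPM.induced_tensor_induced, RoutedCPM.induced_comp_induced]
      refine induced_congr (TensorProduct.ext_threefold fun a c b => ?_) fun _ => rfl
      -- Both sides send `a ⊗ c ⊗ b` to `a ⊗ b` multiplied by the scalar `c`.
      exact (TensorProduct.smul_tmul (R := ℂ) (show ℂ from c) a b).symm)

/-- The braiding is induced by the swap of tensor factors. -/
instance operatorSpaceSymmetricCategory : SymmetricCategory OperatorSpace where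
  braiding A B := inducedIso (UnitaryIso.comm A.base B.base)
  braiding_naturality_right _ _ _ f := RoutedCPM.tensor_comp_comm _ f
  braiding_naturality_left f _ := RoutedCPM.tensor_comp_comm f _
  hexagon_forward A B C := by
    change (RoutedCPM.induced _).comp ((RoutedCPM.induced _).comp (RoutedCPM.induced _)) =
      ((RoutedCPM.induced _).tensor (RoutedCPM.induced _)).comp
        ((RoutedCPM.induced _).comp ((RoutedCPM.induced _).tensor (RoutedCPM.induced _)))
    simp only [RoutedCPM.induced_tensor_induced, RoutedCPM.induced_comp_induced]
    exact induced_congr (TensorProduct.ext_threefold fun _ _ _ => rfl) fun _ => rfl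
  hexagon_reverse A B C := by
    change (RoutedCPM.induced _).comp ((RoutedCPM.induced _).comp (RoutedCPM.induced _)) =
      ((RoutedCPM.induced _).tensor (RoutedCPM.induced _)).comp
        ((RoutedCPM.induced _).comp ((RoutedCPM.induced _).tensor (RoutedCPM.induced _)))
    simp only [RoutedCPM.induced_tensor_induced, RoutedCPM.induced_comp_induced]
    exact induced_congr (TensorProduct.ext_threefold' fun _ _ _ => rfl) fun _ => rfl
  symmetry A B := (RoutedCPM.induced_comp_induced _ _).trans <|
    induced_congr (A := A.tensor B) (B := A.tensor B)
      (TensorProduct.ext' fun _ _ => rfl) fun _ => rfl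

/-- The dagger `(Λ, C) ↦ (Λᵀ, C†)`. -/
instance operatorSpaceDagger : DaggerSymmetricMonoidal OperatorSpace where
  dagger f := RoutedCPM.adjoint f
  dagger_id A := RoutedCPM.induced_adjoint (UnitaryIso.refl A.base)
  dagger_comp := RoutedCPM.adjoint_comp
  dagger_dagger := RoutedCPM.adjoint_adjoint
  dagger_tensor := RoutedCPM.adjoint_tensor
  dagger_associator _ _ _ := RoutedCPM.induced_adjoint _
  dagger_leftUnitor _ := RoutedCPM.induced_adjoint _
  dagger_rightUnitor _ := RoutedCPM.induced_adjoint _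
  dagger_braiding _ _ := RoutedCPM.induced_adjoint _

theorem isInducedBy_induced {A B : OperatorSpace} (U : UnitaryIso A.base B.base) :
    (RoutedCPM.induced U : RoutedCPM A B).IsInducedBy U.unitary.toLinearEquiv U.indexEquiv :=
  ⟨rfl, fun _ => rfl⟩

end Routed

end

theorem mainTheorem4 :
    ∃ (_ : Category.{0} Routed.OperatorSpace) (_ : MonoidalCategory Routed.OperatorSpace)
      (_ : SymmetricCategory Routed.OperatorSpace)
      (_ : DaggerSymmetricMonoidal Routed.OperatorSpace)
      (hom : ∀ A B : Routed.OperatorSpace, (A ⟶ B) ≃ Routed.RoutedCPM A B)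
      (tens : ∀ A B : Routed.OperatorSpace, A ⊗ B = A.tensor B)
      (unit : 𝟙_ Routed.OperatorSpace = Routed.OperatorSpace.unit),
      -- the partition of a tensor product of objects
      (∀ (A B : Routed.OperatorSpace) (k k' : A.base.index) (l l' : B.base.index),
        (A.tensor B).toPartitionedSpace.proj ((k, l), (k', l')) =
          Routed.mapTensor (A.toPartitionedSpace.proj (k, k'))
            (B.toPartitionedSpace.proj (l, l'))) ∧
      -- identities and sequential composition
      (∀ A : Routed.OperatorSpace,
        (hom A A (𝟙 A)).IsInducedBy (LinearEquiv.refl ℂ A.base.space)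
          (Equiv.refl A.base.index)) ∧
      (∀ (A B C : Routed.OperatorSpace) (f : A ⟶ B) (g : B ⟶ C),
        (hom A C (f ≫ g)).IsComp (hom A B f) (hom B C g)) ∧
      -- parallel composition
      (∀ (A B A' B' : Routed.OperatorSpace) (f : A ⟶ B) (g : A' ⟶ B'),
        ((hom (A ⊗ A') (B ⊗ B') (f ⊗ₘ g)).cast (tens A A') (tens B B')).IsTensor
          (hom A B f) (hom A' B' g)) ∧
      -- adjoints
      (∀ (A B : Routed.OperatorSpace) (f : A ⟶ B),
        (hom B A (DaggerSymmetricMonoidal.dagger f)).IsAdjoint (hom A B f)) ∧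
      -- associators, unitors and swaps
      (∀ A B C : Routed.OperatorSpace,
        ((hom ((A ⊗ B) ⊗ C) (A ⊗ (B ⊗ C)) (α_ A B C).hom).cast
          (B := A ⊗ (B ⊗ C)) (A' := (A.tensor B).tensor C) (B' := A.tensor (B.tensor C))
          (by rw [tens, tens]) (by rw [tens, tens])).IsInducedBy
          (TensorProduct.assoc ℂ A.base.space B.base.space C.base.space)
          (Equiv.prodAssoc A.base.index B.base.index C.base.index)) ∧
      (∀ A : Routed.OperatorSpace,
        ((hom (𝟙_ Routed.OperatorSpace ⊗ A) A (λ_ A).hom).cast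
          (A' := Routed.OperatorSpace.unit.tensor A) (by rw [tens, unit]) rfl).IsInducedBy
          (TensorProduct.lid ℂ A.base.space) (Equiv.punitProd A.base.index)) ∧
      (∀ A : Routed.OperatorSpace,
        ((hom (A ⊗ 𝟙_ Routed.OperatorSpace) A (ρ_ A).hom).cast
          (A' := A.tensor Routed.OperatorSpace.unit) (by rw [tens, unit]) rfl).IsInducedBy
          (TensorProduct.rid ℂ A.base.space) (Equiv.prodPUnit A.base.index)) ∧
      (∀ A B : Routed.OperatorSpace,
        ((hom (A ⊗ B) (B ⊗ A) (β_ A B).hom).cast (tens A B) (tens B A)).IsInducedBy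
          (TensorProduct.comm ℂ A.base.space B.base.space)
          (Equiv.prodComm A.base.index B.base.index)) := by
  exact ⟨inferInstance, inferInstance, inferInstance, inferInstance, fun _ _ => Equiv.refl _,
    fun _ _ => rfl, rfl,
    fun A B k k' l l' => Routed.PartitionedSpace.sandwich_tensor A.base B.base k k' l l',
    fun _ => Routed.isInducedBy_induced _,
    fun _ _ _ _ _ => ⟨rfl, rfl⟩,
    fun _ _ _ _ _ _ => ⟨rfl, rfl⟩,
    fun _ _ _ => ⟨rfl, rfl⟩,
    fun A B C => Routed.isInducedBy_induced (.assoc A.base B.base C.base),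
    fun A => Routed.isInducedBy_induced (.leftUnitor A.base),
    fun A => Routed.isInducedBy_induced (.rightUnitor A.base),
    fun A B => Routed.isInducedBy_induced (.comm A.base B.base)⟩
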